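/- All graphs are finite and simple (no loops or parallel edges), and $|G|$ denotes the number of vertices of $G$. A graph $G$ is $\varepsilon$-sparse if every vertex of $G$ has degree less than $\varepsilon|G|$. For real $\gamma,\delta\ge 0$, $G$ is $(\gamma,\delta)$-coherent if there are no disjoint sets $A,B\subseteq V(G)$ with $|A|\ge\gamma$ and $|B|\ge\delta$ such that no vertex of $A$ has a neighbour in $B$. Theorem. Let $c>0$ be a real number with $1/c$ an integer, and let $\ell\ge 3/c+3$ be an integer. Then there exists $\varepsilon>0$ such that every $\varepsilon$-sparse $(\varepsilon|G|^{1-c},\varepsilon|G|)$-coherent graph $G$ with $|G|>1$ has an induced cycle of length $\ell$, that is, an induced subgraph isomorphic to the cycle with $\ell$ vertices. -/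

import Mathlib

namespace PurePairs

/-- `A, B` is an anticomplete pair of `G`: the sets are disjoint and no vertex of `A` has a
neighbour in `B`. -/
def Anticomplete {V : Type*} (G : SimpleGraph V) (A B : Finset V) : Prop :=
  Disjoint A B ∧ ∀ a ∈ A, ∀ b ∈ B, ¬ G.Adj a b

/-- `G` is `ε`-sparse: every vertex has degree less than `ε |G|`. -/
def IsSparse {V : Type*} [Fintype V] (G : SimpleGraph V) [DecidableRel G.Adj] (ε : ℝ) : Prop :=
  ∀ v : V, (G.degree v : ℝ) < ε * (Fintype.card V : ℝ)

/-- `G` is `(γ, δ)`-coherent: there is no anticomplete pair `A, B` with `|A| ≥ γ` and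
`|B| ≥ δ`. -/
def IsCoherent {V : Type*} (G : SimpleGraph V) (γ δ : ℝ) : Prop :=
  ¬ ∃ A B : Finset V, Anticomplete G A B ∧ γ ≤ (A.card : ℝ) ∧ δ ≤ (B.card : ℝ)

/-- `G` has an induced cycle of length `n` (used for `n ≥ 3`): some induced subgraph of `G` is
isomorphic to the cycle graph on `n` vertices. -/
def HasInducedCycle {V : Type*} (G : SimpleGraph V) (n : ℕ) : Prop :=
  (SimpleGraph.cycleGraph n).IsIndContained G

end PurePairs

/-! Put n = |G|, m = 1/c, ν = n^c, e = εn and γ = εn^(1-c), so γν = e and ν^m = n. By coherence, a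
set of at least γ vertices has neighbours in all but fewer than e of the vertices outside it. Hence,
after deleting at most e vertices, small sets expand by the factor ν (`exists_expanding`), and balls
of radius m - 1 already have γ vertices (`le_card_ball`).

The cycle has three arcs. The first joins p to q through a set C and has length d ≤ 2m:
`exists_root` supplies C and a set S of neighbours of C, any two joined through C, such that S sees
much of the set Ω of vertices outside C with no neighbour in C. An increasing chain A of subsets of
S (`exists_chain_nbrs`) cuts part of Ω into ordered blocks, block i being seen by A (i+1) but not by
A i. Let x be in the last block and p a neighbour of x in the chain. The second arc is a shortest
path of length j + 1 ≤ m from x into an expanding set F ⊆ Ω that the chain does not see, stopping at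
a sphere that reaches many blocks. The third (`exists_descending_path`) continues through the blocks
for t + 1 edges and ends at y in the earliest block it visits. A neighbour q of y in that block's
set A (i+1) sees neither F nor later blocks, so px and qy are the only edges between the first arc
and the rest.

Pigeonhole fixes d and j over all blocks used before t is chosen. The length d + (j+1) + t + 3 can
therefore be made equal to l, and l ≥ 3m + 3 ensures t ≥ 0. -/

namespace PurePairs

/-! ### Induced paths and cycles -/

variable {V : Type*}

/-- `f 0, …, f d` is an induced path of length `d`. -/
def IsInducedPath (G : SimpleGraph V) (f : ℕ → V) (d : ℕ) : Prop :=
  ∀ i j, i < j → j ≤ d → f i ≠ f j ∧ (G.Adj (f i) (f j) ↔ j = i + 1)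

theorem IsInducedPath.adj_iff {G : SimpleGraph V} {f : ℕ → V} {d : ℕ} (h : IsInducedPath G f d)
    {i j : ℕ} (hi : i ≤ d) (hj : j ≤ d) : G.Adj (f i) (f j) ↔ j = i + 1 ∨ i = j + 1 := by
  rcases lt_trichotomy i j with hij | rfl | hij
  · rw [(h i j hij hj).2]; omega
  · simp
  · rw [G.adj_comm, (h j i hij hi).2]; omega

theorem IsInducedPath.injOn {G : SimpleGraph V} {f : ℕ → V} {d : ℕ} (h : IsInducedPath G f d)
    {i j : ℕ} (hi : i ≤ d) (hj : j ≤ d) (hf : f i = f j) : i = j := by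
  rcases lt_trichotomy i j with hij | rfl | hij
  · exact absurd hf (h i j hij hj).1
  · rfl
  · exact absurd hf.symm (h j i hij hi).1

/-- Two induced paths joined by a single edge, from the end of the first to the start of the
second, form an induced path. -/
theorem IsInducedPath.append {G : SimpleGraph V} {f g : ℕ → V} {d e : ℕ}
    (hf : IsInducedPath G f d) (hg : IsInducedPath G g e)
    (hne : ∀ i j, i ≤ d → j ≤ e → f i ≠ g j)
    (hadj : ∀ i j, i ≤ d → j ≤ e → (G.Adj (f i) (g j) ↔ i = d ∧ j = 0)) :
    IsInducedPath G (fun i => if i ≤ d then f i else g (i - (d + 1))) (d + e + 1) := by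
  intro i j hij hj
  by_cases hjd : j ≤ d
  · have hid : i ≤ d := by omega
    simp only [hid, hjd, if_true]
    exact hf i j hij hjd
  · by_cases hid : i ≤ d
    · simp only [hid, hjd, if_true, if_false]
      refine ⟨hne i _ hid (by omega), ?_⟩
      rw [hadj i _ hid (by omega)]
      omega
    · simp only [hid, hjd, if_false]
      have := hg (i - (d + 1)) (j - (d + 1)) (by omega) (by omega)
      refine ⟨this.1, ?_⟩
      rw [this.2]
      omega

theorem IsInducedPath.tail {G : SimpleGraph V} {g : ℕ → V} {d : ℕ}
    (h : IsInducedPath G g (d + 1)) : IsInducedPath G (fun s => g (s + 1)) d := by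
  intro i j hij hj
  obtain ⟨h1, h2⟩ := h (i + 1) (j + 1) (by omega) (by omega)
  exact ⟨h1, by rw [h2]; omega⟩

/-- Two induced paths whose only connections are an edge between their starts and an edge between
their ends form an induced cycle. -/
theorem IsInducedPath.hasInducedCycle {G : SimpleGraph V} {f g : ℕ → V} {d e : ℕ}
    (hf : IsInducedPath G f d) (hg : IsInducedPath G g e) (hd : 1 ≤ d) (he : 1 ≤ e)
    (hne : ∀ i j, i ≤ d → j ≤ e → f i ≠ g j)
    (hadj : ∀ i j, i ≤ d → j ≤ e → (G.Adj (f i) (g j) ↔ (i = 0 ∧ j = 0) ∨ (i = d ∧ j = e))) :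
    HasInducedCycle G (d + e + 2) := by
  -- Traverse f forwards, then g backwards.
  let h : Fin (d + e + 2) → V := fun i =>
    if (i : ℕ) ≤ d then f i else g (d + e + 1 - i)
  have hinj : Function.Injective h := by
    intro i j hij
    have hi := i.2
    have hj := j.2
    by_cases hid : (i : ℕ) ≤ d <;> by_cases hjd : (j : ℕ) ≤ d <;>
      simp only [h, hid, hjd, if_true, if_false] at hij
    · exact Fin.ext (hf.injOn hid hjd hij)
    · exact absurd hij (hne _ _ hid (by omega))
    · exact absurd hij.symm (hne _ _ hjd (by omega))
    · have := hg.injOn (by omega) (by omega) hij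
      exact Fin.ext (by omega)
  refine ⟨⟨⟨h, hinj⟩, ?_⟩⟩
  intro i j
  have hi := i.2
  have hj := j.2
  have hsub : ∀ a b : Fin (d + e + 2), (a - b).val = 1 ↔
      (a.val = b.val + 1 ∨ (a.val = 0 ∧ b.val = d + e + 1)) := by
    intro a b
    have ha := a.2
    have hb := b.2
    rw [Fin.val_sub]
    rcases le_or_gt b.val a.val with hab | hab
    · rw [show d + e + 2 - b.val + a.val = (a.val - b.val) + (d + e + 2) by omega,
        Nat.add_mod_right, Nat.mod_eq_of_lt (by omega)]
      omega
    · rw [Nat.mod_eq_of_lt (by omega)]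
      omega
  rw [SimpleGraph.cycleGraph_adj', hsub, hsub]
  change G.Adj (h i) (h j) ↔ _
  by_cases hid : (i : ℕ) ≤ d <;> by_cases hjd : (j : ℕ) ≤ d <;>
    simp only [h, hid, hjd, if_true, if_false]
  · rw [hf.adj_iff hid hjd]; omega
  · rw [hadj _ _ hid (by omega)]; omega
  · rw [G.adj_comm, hadj _ _ hjd (by omega)]; omega
  · rw [hg.adj_iff (by omega) (by omega)]; omega

/-! ### Cardinalities and neighbourhoods -/

section Card

variable [DecidableEq V]

theorem card_sub_le_card_sdiff (A B : Finset V) :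
    (A.card : ℝ) - (B.card : ℝ) ≤ ((A \ B).card : ℝ) := by
  have : A.card ≤ (A \ B).card + B.card := by
    have := Finset.le_card_sdiff B A; omega
  have : (A.card : ℝ) ≤ (A \ B).card + B.card := by exact_mod_cast this
  linarith

theorem card_eq_card_sdiff_add (A B : Finset V) :
    (A.card : ℝ) = ((A \ B).card : ℝ) + ((B ∩ A).card : ℝ) := by
  have := Finset.card_sdiff_add_card_inter A B
  rw [Finset.inter_comm] at this
  exact_mod_cast this.symm

end Card

variable [Fintype V]

open Classical in
/-- The set of vertices with a neighbour in `A`. -/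
noncomputable def nbrs (G : SimpleGraph V) (A : Finset V) : Finset V :=
  Finset.univ.filter fun w => ∃ a ∈ A, G.Adj a w

@[simp] theorem mem_nbrs {G : SimpleGraph V} {A : Finset V} {w : V} :
    w ∈ nbrs G A ↔ ∃ a ∈ A, G.Adj a w := by
  simp [nbrs]

theorem nbrs_mono {G : SimpleGraph V} {A B : Finset V} (h : A ⊆ B) : nbrs G A ⊆ nbrs G B := by
  intro w hw
  obtain ⟨a, ha, haw⟩ := mem_nbrs.1 hw
  exact mem_nbrs.2 ⟨a, h ha, haw⟩

theorem card_nbrs_lt_of_card_le_one {G : SimpleGraph V} {e : ℝ} (he : 0 < e)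
    (hdeg : ∀ v, ((nbrs G {v}).card : ℝ) < e) {M : Finset V} (hM : M.card ≤ 1) :
    ((nbrs G M).card : ℝ) < e := by
  rcases Nat.le_one_iff_eq_zero_or_eq_one.1 hM with h | h
  · rw [Finset.card_eq_zero] at h
    have : nbrs G M = ∅ := by ext; simp [h]
    simpa [this] using he
  · obtain ⟨v, rfl⟩ := Finset.card_eq_one.1 h
    exact hdeg v

variable [DecidableEq V]

theorem nbrs_union (G : SimpleGraph V) (A B : Finset V) :
    nbrs G (A ∪ B) = nbrs G A ∪ nbrs G B := by
  ext w
  simp only [mem_nbrs, Finset.mem_union]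
  constructor
  · rintro ⟨a, ha | ha, h⟩
    exacts [Or.inl ⟨a, ha, h⟩, Or.inr ⟨a, ha, h⟩]
  · rintro (⟨a, ha, h⟩ | ⟨a, ha, h⟩)
    exacts [⟨a, Or.inl ha, h⟩, ⟨a, Or.inr ha, h⟩]

/-! ### Balls and shortest paths -/

/-- The vertices reachable from `x` by at most `j` steps, each step leading into `R`. -/
noncomputable def ball (G : SimpleGraph V) (R : Finset V) (x : V) : ℕ → Finset V
  | 0 => {x}
  | j + 1 => ball G R x j ∪ (nbrs G (ball G R x j) ∩ R)

theorem ball_subset_succ (G : SimpleGraph V) (R : Finset V) (x : V) (j : ℕ) :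
    ball G R x j ⊆ ball G R x (j + 1) := Finset.subset_union_left

theorem ball_mono (G : SimpleGraph V) (R : Finset V) (x : V) : Monotone (ball G R x) :=
  monotone_nat_of_le_succ (ball_subset_succ G R x)

theorem mem_ball_succ_of_adj {G : SimpleGraph V} {R : Finset V} {x u w : V} {j : ℕ}
    (hu : u ∈ ball G R x j) (hw : w ∈ R) (h : G.Adj u w) : w ∈ ball G R x (j + 1) :=
  Finset.mem_union_right _ (Finset.mem_inter.2 ⟨mem_nbrs.2 ⟨u, hu, h⟩, hw⟩)

theorem ball_subset (G : SimpleGraph V) (R : Finset V) (x : V) (j : ℕ) :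
    ball G R x j ⊆ insert x R := by
  induction j with
  | zero => intro w hw; simp_all [ball]
  | succ j ih =>
    apply Finset.union_subset ih
    exact Finset.inter_subset_right.trans (Finset.subset_insert _ _)

theorem mem_ball_of_walk {G : SimpleGraph V} {R : Finset V} {x : V} {f : ℕ → V} {s d : ℕ}
    (h0 : f 0 ∈ ball G R x s) (hR : ∀ i, 0 < i → i ≤ d → f i ∈ R)
    (hadj : ∀ i < d, G.Adj (f i) (f (i + 1))) : f d ∈ ball G R x (s + d) := by
  induction d with
  | zero => exact h0
  | succ d ih =>
    exact mem_ball_succ_of_adj (ih (fun i hi hid => hR i hi (by omega))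
      fun i hi => hadj i (by omega)) (hR _ (by omega) le_rfl) (hadj d (by omega))

/-- A vertex first reached after `j` steps is the end of an induced path of length `j`. -/
theorem exists_inducedPath_of_mem_ball {G : SimpleGraph V} {R : Finset V} {x b : V} {j : ℕ}
    (hb : b ∈ ball G R x j) (hb' : ∀ i < j, b ∉ ball G R x i) :
    ∃ f : ℕ → V, IsInducedPath G f j ∧ f 0 = x ∧ f j = b ∧ ∀ i ≤ j, f i ∈ ball G R x i := by
  induction j generalizing b with
  | zero =>
    have hb0 : b = x := by simpa [ball] using hb
    refine ⟨fun _ => x, ?_, rfl, hb0.symm, ?_⟩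
    · intro i j hij hj; omega
    · intro i hi
      obtain rfl : i = 0 := by omega
      simp [ball]
  | succ j ih =>
    have hbj : b ∉ ball G R x j := hb' j (by omega)
    obtain ⟨hbn, hbR⟩ := Finset.mem_inter.1 ((Finset.mem_union.1 hb).resolve_left hbj)
    obtain ⟨u, hu, hub⟩ := mem_nbrs.1 hbn
    -- Since b is first reached at step j + 1, it has no neighbour in a ball of radius below j; so
    -- only the end of the path to u is adjacent to b.
    have hnot : ∀ i < j, ∀ w ∈ ball G R x i, ¬ G.Adj w b := fun i hi w hw hwb =>
      hb' (i + 1) (by omega) (mem_ball_succ_of_adj hw hbR hwb)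
    obtain ⟨f, hf, hf0, hfj, hfm⟩ := ih hu fun i hi hui => hnot i hi u hui hub
    refine ⟨fun i => if i ≤ j then f i else b, ?_, by simp [hf0], by simp, ?_⟩
    · have hb1 : IsInducedPath G (fun _ => b) 0 := by intro i j hij hj; omega
      refine hf.append hb1 (fun i k hi _ h => hbj ?_) fun i k hi hk => ?_
      · rw [← h]; exact ball_mono G R x hi (hfm i hi)
      · constructor
        · intro h
          refine ⟨?_, by omega⟩
          by_contra hij
          exact hnot i (by omega) _ (hfm i hi) h
        · rintro ⟨rfl, -⟩
          rwa [hfj]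
    · intro i hi
      by_cases hij : i ≤ j
      · simp only [hij, if_true]; exact hfm i hij
      · obtain rfl : i = j + 1 := by omega
        simpa using hb

/-! ### Coherence and expansion -/

theorem IsCoherent.card_sdiff_lt {G : SimpleGraph V} {γ e : ℝ} (h : IsCoherent G γ e)
    {A : Finset V} (hA : γ ≤ (A.card : ℝ)) (B : Finset V) :
    ((B \ (A ∪ nbrs G A)).card : ℝ) < e := by
  by_contra hB
  refine h ⟨A, B \ (A ∪ nbrs G A), ⟨?_, ?_⟩, hA, not_lt.1 hB⟩
  · rw [Finset.disjoint_left]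
    intro a ha hab
    simp_all
  · intro a ha b hb hab
    have : b ∈ nbrs G A := mem_nbrs.2 ⟨a, ha, hab⟩
    simp_all

theorem IsCoherent.card_le_card_nbrs_inter {G : SimpleGraph V} {γ e : ℝ} (h : IsCoherent G γ e)
    {A B : Finset V} (hA : γ ≤ (A.card : ℝ)) (hAB : Disjoint A B) :
    (B.card : ℝ) - e ≤ ((nbrs G A ∩ B).card : ℝ) := by
  have h1 := h.card_sdiff_lt hA B
  have h2 : B ⊆ (B \ (A ∪ nbrs G A)) ∪ (nbrs G A ∩ B) := by
    intro b hb
    have := Finset.disjoint_right.1 hAB hb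
    by_cases hbn : b ∈ nbrs G A
    · exact Finset.mem_union_right _ (Finset.mem_inter.2 ⟨hbn, hb⟩)
    · refine Finset.mem_union_left _ (Finset.mem_sdiff.2 ⟨hb, fun h => ?_⟩)
      exact (Finset.mem_union.1 h).elim this hbn
  have h3 : (B.card : ℝ) ≤ ((B \ (A ∪ nbrs G A)).card : ℝ) + ((nbrs G A ∩ B).card : ℝ) := by
    exact_mod_cast (Finset.card_le_card h2).trans (Finset.card_union_le _ _)
  linarith

/-- Every set of vertices contains, up to fewer than `e` vertices, a set in which small
sets expand by the factor `ν`. -/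
theorem exists_expanding {G : SimpleGraph V} {γ ν e : ℝ} (hcoh : IsCoherent G γ e) (hν : 0 ≤ ν)
    (hγ : 0 ≤ γ) (hγν : γ * ν = e) {R : Finset V} (hR : 3 * e ≤ (R.card : ℝ)) :
    ∃ R' ⊆ R, (R.card : ℝ) - e ≤ (R'.card : ℝ) ∧ ∀ Y ⊆ R', Y.Nonempty →
      (Y.card : ℝ) * ν ≤ ((Y ∪ (nbrs G Y ∩ R')).card : ℝ) ∨
        e ≤ ((Y ∪ (nbrs G Y ∩ R')).card : ℝ) := by
  classical
  -- Delete the closed neighbourhood of a largest badly expanding set X of size at most γ; it covers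
  -- at most γν = e vertices of R.
  let S := R.powerset.filter fun X : Finset V =>
    (X.card : ℝ) ≤ γ ∧ (((X ∪ nbrs G X) ∩ R).card : ℝ) ≤ (X.card : ℝ) * ν
  have hS : S.Nonempty := ⟨∅, by
    have : nbrs G ∅ = ∅ := by ext; simp
    simp [S, this, hγ]⟩
  obtain ⟨X, hXS, hXmax⟩ := S.exists_max_image Finset.card hS
  obtain ⟨hXR, hXγ, hXν⟩ := by simpa [S] using hXS
  have hXe : (((X ∪ nbrs G X) ∩ R).card : ℝ) ≤ e :=
    hXν.trans (by rw [← hγν]; exact mul_le_mul_of_nonneg_right hXγ hν)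
  refine ⟨R \ (X ∪ nbrs G X), Finset.sdiff_subset, ?_, ?_⟩
  · have := card_eq_card_sdiff_add R (X ∪ nbrs G X)
    linarith
  · intro Y hY hYne
    have hYX : Disjoint Y X := by
      rw [Finset.disjoint_left]
      intro y hy hyX
      have := hY hy
      simp_all
    have hcard : ((X ∪ Y).card : ℝ) = X.card + Y.card := by
      exact_mod_cast Finset.card_union_of_disjoint hYX.symm
    have hsub : ((X ∪ Y) ∪ nbrs G (X ∪ Y)) ∩ R ⊆
        ((X ∪ nbrs G X) ∩ R) ∪ (Y ∪ (nbrs G Y ∩ (R \ (X ∪ nbrs G X)))) := by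
      rw [nbrs_union]
      intro w hw
      simp only [Finset.mem_union, Finset.mem_inter, Finset.mem_sdiff] at hw ⊢
      tauto
    have hsubc : ((((X ∪ Y) ∪ nbrs G (X ∪ Y)) ∩ R).card : ℝ) ≤
        ((X ∪ nbrs G X) ∩ R).card + (Y ∪ (nbrs G Y ∩ (R \ (X ∪ nbrs G X)))).card := by
      exact_mod_cast (Finset.card_le_card hsub).trans (Finset.card_union_le _ _)
    -- If X ∪ Y is still small, a badly expanding Y would contradict maximality of X. Otherwise
    -- coherence applies to X ∪ Y, and |R| ≥ 3e leaves e vertices for Y.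
    rcases le_or_gt ((X ∪ Y).card : ℝ) γ with hle | hgt
    · left
      by_contra hlt
      have hmem : X ∪ Y ∈ S := by
        simp only [S, Finset.mem_filter, Finset.mem_powerset]
        refine ⟨Finset.union_subset hXR (hY.trans Finset.sdiff_subset), hle, ?_⟩
        rw [hcard, add_mul]
        linarith
      have h1 := hXmax _ hmem
      have h2 : (X ∪ Y).card = X.card + Y.card := Finset.card_union_of_disjoint hYX.symm
      have := hYne.card_pos
      omega
    · right
      have h1 := hcoh.card_sdiff_lt hgt.le R
      have h2 := card_eq_card_sdiff_add R ((X ∪ Y) ∪ nbrs G (X ∪ Y))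
      linarith

theorem card_ball_ge {G : SimpleGraph V} {ν e : ℝ} (hν : 1 ≤ ν) {R : Finset V}
    (hR : ∀ Y ⊆ R, Y.Nonempty → (Y.card : ℝ) * ν ≤ ((Y ∪ (nbrs G Y ∩ R)).card : ℝ) ∨
        e ≤ ((Y ∪ (nbrs G Y ∩ R)).card : ℝ)) {x : V} (hx : x ∈ R) (j : ℕ) :
    ν ^ j ≤ ((ball G R x j).card : ℝ) ∨ e ≤ ((ball G R x j).card : ℝ) := by
  induction j with
  | zero => left; simp [ball]
  | succ j ih =>
    have hsub : ball G R x j ⊆ R := (ball_subset G R x j).trans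
      (Finset.insert_subset hx subset_rfl)
    have hne : (ball G R x j).Nonempty := ⟨x, ball_mono G R x (Nat.zero_le j) (by simp [ball])⟩
    have hmono : ((ball G R x j).card : ℝ) ≤ ((ball G R x (j + 1)).card : ℝ) := by
      exact_mod_cast Finset.card_le_card (ball_subset_succ G R x j)
    rcases ih with ih | ih
    · rcases hR _ hsub hne with h | h
      · left
        rw [pow_succ]
        exact (mul_le_mul_of_nonneg_right ih (by linarith)).trans h
      · exact Or.inr h
    · right; linarith

/-! ### Descending paths through blocks -/

theorem card_nbrs_inter_le_of_small {G : SimpleGraph V} {γ : ℝ} (hγ : 0 ≤ γ) {s : ℕ} (hs : 1 ≤ s)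
    (Z M : Finset V)
    (h : ∀ M' ⊆ M, M'.card ≤ s → ((nbrs G M' ∩ Z).card : ℝ) ≤ γ) :
    ((nbrs G M ∩ Z).card : ℝ) ≤ γ * ((M.card : ℝ) / s + 1) := by
  have hs0 : (0 : ℝ) < s := by exact_mod_cast hs
  induction hk : M.card using Nat.strong_induction_on generalizing M with
  | _ k ih =>
    rcases le_or_gt M.card s with hle | hgt
    · have h1 := h M subset_rfl hle
      have : 0 ≤ γ * ((k : ℝ) / s) := by positivity
      linarith
    · obtain ⟨M₁, hM₁, hc⟩ := Finset.exists_subset_card_eq hgt.le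
      have hcs : (M \ M₁).card = k - s := by rw [Finset.card_sdiff_of_subset hM₁, hc, hk]
      have h1 := ih (k - s) (by omega) (M \ M₁)
        (fun M' hM' => h M' (hM'.trans Finset.sdiff_subset)) hcs
      have h2 := h M₁ hM₁ hc.le
      have h3 : nbrs G M ∩ Z ⊆ (nbrs G M₁ ∩ Z) ∪ (nbrs G (M \ M₁) ∩ Z) := by
        rw [← Finset.union_inter_distrib_right, ← nbrs_union, Finset.union_sdiff_of_subset hM₁]
      have h4 : ((nbrs G M ∩ Z).card : ℝ) ≤
          (nbrs G M₁ ∩ Z).card + (nbrs G (M \ M₁) ∩ Z).card := by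
        exact_mod_cast (Finset.card_le_card h3).trans (Finset.card_union_le _ _)
      have h5 : ((k - s : ℕ) : ℝ) / s + 1 = (k : ℝ) / s := by
        rw [Nat.cast_sub (by omega), sub_div, div_self hs0.ne']
        ring
      rw [h5] at h1
      linarith

/-- Cut M into at most about 2ν pieces of size ⌊|M|/ν⌋, or into singletons if |M| < 2ν. If every
piece had fewer than γ neighbours in Z, M would have at most γ(2ν + 1) ≤ 3e there. -/
theorem exists_small_subset {G : SimpleGraph V} {γ ν e : ℝ} (hν : 1 ≤ ν) (hγ : 0 ≤ γ)
    (hγν : γ * ν = e) {M Z : Finset V} (h : 3 * e < ((nbrs G M ∩ Z).card : ℝ)) :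
    ∃ M' ⊆ M, γ ≤ ((nbrs G M' ∩ Z).card : ℝ) ∧
      (M'.card ≤ 1 ∨ (M'.card : ℝ) * ν ≤ (M.card : ℝ)) := by
  by_contra! H
  have hν0 : 0 < ν := by linarith
  have hγe : γ ≤ e := by nlinarith
  rcases lt_or_ge ((M.card : ℝ) / ν) 2 with h2 | h2
  · have := card_nbrs_inter_le_of_small (G := G) hγ le_rfl Z M fun M' hM' hc => by
      by_contra! hlt
      have := (H M' hM' hlt.le).1
      omega
    rw [div_lt_iff₀ hν0] at h2
    have h3 : γ * (M.card : ℝ) ≤ γ * (2 * ν) := mul_le_mul_of_nonneg_left h2.le hγ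
    push_cast at this
    nlinarith
  · have hfl := Nat.lt_floor_add_one ((M.card : ℝ) / ν)
    have hfl' := Nat.floor_le (a := (M.card : ℝ) / ν) (by positivity)
    set s := ⌊(M.card : ℝ) / ν⌋₊
    have hs1 : (1 : ℝ) ≤ s := by linarith
    have hs0 : (0 : ℝ) < s := by linarith
    have := card_nbrs_inter_le_of_small (G := G) hγ (s := s) (by exact_mod_cast hs1) Z M
      fun M' hM' hc => by
        by_contra! hlt
        have h1 := (H M' hM' hlt.le).2
        have h3 : (M'.card : ℝ) ≤ s := by exact_mod_cast hc
        have h4 := (le_div_iff₀ hν0).1 (h3.trans hfl')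
        linarith
    have h6 : (M.card : ℝ) / s ≤ 2 * ν := by
      rw [div_le_iff₀ hs0]
      have : (M.card : ℝ) / ν ≤ 2 * s := by linarith
      rw [div_le_iff₀ hν0] at this
      linarith
    have h7 : γ * ((M.card : ℝ) / s + 1) ≤ γ * (2 * ν + 1) :=
      mul_le_mul_of_nonneg_left (by linarith) hγ
    nlinarith

/-- Among many blocks all reached from `B` there is one in which some subset of `B` has at least
`γ` neighbours while missing half of each of many of the earlier blocks. -/
theorem exists_subset_missing_many {G : SimpleGraph V} {γ ν e δ : ℝ} {m K : ℕ} (hν : 1 < ν)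
    (hγ : 0 ≤ γ) (hγν : γ * ν = e) (he : 0 < e) (hV : ν ^ m = (Fintype.card V : ℝ))
    (hdeg : ∀ v, ((nbrs G {v}).card : ℝ) < e) (hδ : 3 * e < δ)
    {I : Finset ℕ} (hI : (m + 2) * K + 1 ≤ I.card) {Z : ℕ → Finset V} {B : Finset V}
    (hZ : ∀ i ∈ I, 2 * δ ≤ ((Z i).card : ℝ)) (hB : ∀ i ∈ I, δ ≤ ((nbrs G B ∩ Z i).card : ℝ)) :
    ∃ b ∈ I, ∃ M ⊆ B, γ ≤ ((nbrs G M ∩ Z b).card : ℝ) ∧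
      K ≤ (I.filter fun a => a < b ∧ (Z a).card ≤ 2 * (Z a \ nbrs G M).card).card := by
  by_contra! H
  -- If the claim fails, M can be shrunk by a factor ν again and again while still reaching δ
  -- vertices of some block b; each round discards at most K indices, so blocks remain below b.
  have key : ∀ s ≤ m + 1, ∃ b ∈ I, ∃ M ⊆ B, δ ≤ ((nbrs G M ∩ Z b).card : ℝ) ∧
      (M.card : ℝ) * ν ^ s ≤ Fintype.card V ∧
      I.card ≤ (I.filter fun a => a < b).card + 1 + s * K := by
    intro s
    induction s with
    | zero =>
      intro _
      have hne : I.Nonempty := Finset.card_pos.1 (by omega)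
      refine ⟨I.max' hne, I.max'_mem hne, B, subset_rfl, hB _ (I.max'_mem hne), ?_, ?_⟩
      · simp only [pow_zero, mul_one]
        exact_mod_cast Finset.card_le_univ B
      · have : I ⊆ insert (I.max' hne) (I.filter fun a => a < I.max' hne) := by
          intro a ha
          rcases (I.le_max' a ha).lt_or_eq with h | h
          · exact Finset.mem_insert_of_mem (Finset.mem_filter.2 ⟨ha, h⟩)
          · exact Finset.mem_insert.2 (Or.inl h)
        have h1 := (Finset.card_le_card this).trans (Finset.card_insert_le _ _)
        omega
    | succ s ih =>
      intro hs
      obtain ⟨b, hb, M, hMB, hMδ, hMs, hIc⟩ := ih (by omega)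
      obtain ⟨M', hM', hM'γ, hM'c⟩ := exists_small_subset (Z := Z b) hν.le hγ hγν (hδ.trans_le hMδ)
      have hlt := H b hb M' (hM'.trans hMB) hM'γ
      have hbelow : K ≤ (I.filter fun a => a < b).card := by
        have h1 : s * K ≤ m * K := Nat.mul_le_mul_right K (by omega)
        have h2 : (m + 2) * K = m * K + 2 * K := by ring
        omega
      set S := I.filter fun a => a < b ∧ (Z a).card ≤ 2 * (Z a \ nbrs G M').card with hS
      set T := I.filter fun a => a < b ∧ ¬ (Z a).card ≤ 2 * (Z a \ nbrs G M').card with hT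
      have hST : (I.filter fun a => a < b) ⊆ S ∪ T := by
        intro a ha
        simp only [hS, hT, Finset.mem_union, Finset.mem_filter] at ha ⊢
        tauto
      have hTne : T.Nonempty := by
        rw [Finset.nonempty_iff_ne_empty]
        intro hT0
        rw [hT0, Finset.union_empty] at hST
        have := Finset.card_le_card hST
        omega
      have hTmem := T.max'_mem hTne
      -- The latest earlier block of which M' sees more than half. The blocks passed over are half
      -- missed, so there are fewer than K of them.
      set a := T.max' hTne
      obtain ⟨haI, hab, haZ⟩ := by simpa [hT] using hTmem
      have haZ' : 2 * ((Z a \ nbrs G M').card : ℝ) < (Z a).card := by exact_mod_cast haZ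
      have hsp := card_eq_card_sdiff_add (Z a) (nbrs G M')
      rcases hM'c with hM'1 | hM'ν
      · have h1 := card_nbrs_lt_of_card_le_one he hdeg hM'1
        have h2 := card_sub_le_card_sdiff (Z a) (nbrs G M')
        have h3 := hZ a haI
        linarith
      · refine ⟨a, haI, M', hM'.trans hMB, ?_, ?_, ?_⟩
        · have h3 := hZ a haI
          linarith
        · rw [pow_succ', ← mul_assoc]
          exact (mul_le_mul_of_nonneg_right hM'ν (by positivity)).trans hMs
        · have hsub : (I.filter fun a' => a' < b) ⊆
              insert a ((I.filter fun a' => a' < a) ∪ S) := by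
            intro a' ha'
            rcases Finset.mem_union.1 (hST ha') with h | h
            · simp [h]
            · rcases (T.le_max' a' h).lt_or_eq with h1 | h1
              · have : a' ∈ I := (Finset.mem_filter.1 ha').1
                refine Finset.mem_insert_of_mem (Finset.mem_union_left _ ?_)
                exact Finset.mem_filter.2 ⟨this, h1⟩
              · exact Finset.mem_insert.2 (Or.inl h1)
          have h1 := (Finset.card_le_card hsub).trans (Finset.card_insert_le _ _)
          have h2 := Finset.card_union_le (I.filter fun a' => a' < a) S
          have h3 : (s + 1) * K = s * K + K := by ring
          omega
  obtain ⟨b, hb, M, hMB, hMδ, hMs, -⟩ := key (m + 1) le_rfl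
  -- After m + 1 rounds |M| ≤ n/ν^(m+1) < 1, so M is empty yet has δ neighbours.
  have hνm : 0 < ν ^ m := by positivity
  have hM0 : M.card = 0 := by
    by_contra h0
    have h1 : (1 : ℝ) ≤ M.card := by exact_mod_cast Nat.one_le_iff_ne_zero.2 h0
    rw [pow_succ, ← hV] at hMs
    have h2 : ν ^ m * ν ≤ M.card * (ν ^ m * ν) := by
      exact le_mul_of_one_le_left (by positivity) h1
    nlinarith
  have := card_nbrs_lt_of_card_le_one he hdeg (M := M) (by omega)
  have h2 : ((nbrs G M ∩ Z b).card : ℝ) ≤ (nbrs G M).card := by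
    exact_mod_cast Finset.card_le_card Finset.inter_subset_left
  linarith

/-- A number of blocks sufficient to find a descending path with `t + 1` edges. -/
def blockBound (m : ℕ) : ℕ → ℕ
  | 0 => 1
  | t + 1 => (m + 2) * blockBound m t + 1

theorem blockBound_mono (m : ℕ) : Monotone (blockBound m) := by
  refine monotone_nat_of_le_succ fun t => ?_
  simp only [blockBound]
  nlinarith [Nat.zero_le (m * blockBound m t), Nat.zero_le (blockBound m t)]

/-- From a set `B` reaching each of sufficiently many ordered blocks, there is an induced path with
`t + 1` edges starting in `B` whose remaining vertices lie in blocks, the last of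
them in the earliest block. -/
theorem exists_descending_path {G : SimpleGraph V} {γ ν e δ : ℝ} {m : ℕ} (hν : 1 < ν)
    (hγ : 0 ≤ γ) (hγν : γ * ν = e) (he : 0 < e) (hV : ν ^ m = (Fintype.card V : ℝ))
    (hdeg : ∀ v, ((nbrs G {v}).card : ℝ) < e) (hcoh : IsCoherent G γ e) (hδ : 3 * e < δ)
    (t : ℕ) {I : Finset ℕ} (hI : blockBound m t ≤ I.card) {Z : ℕ → Finset V} {B : Finset V}
    (hdisj : ∀ i ∈ I, ∀ j ∈ I, i ≠ j → Disjoint (Z i) (Z j))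
    (hBZ : ∀ i ∈ I, Disjoint B (Z i))
    (hZ : ∀ i ∈ I, 2 ^ (t + 1) * δ ≤ ((Z i).card : ℝ))
    (hB : ∀ i ∈ I, δ ≤ ((nbrs G B ∩ Z i).card : ℝ)) :
    ∃ g : ℕ → V, IsInducedPath G g (t + 1) ∧ g 0 ∈ B ∧ ∃ i ∈ I, g (t + 1) ∈ Z i ∧
      ∀ s, 1 ≤ s → s ≤ t → ∃ i' ∈ I, i < i' ∧ g s ∈ Z i' := by
  have hδ0 : 0 < δ := by linarith
  induction t generalizing I Z B with
  | zero =>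
    obtain ⟨i, hi⟩ := Finset.card_pos.1 (show 0 < I.card from hI)
    have h1 := hB i hi
    have hne : (nbrs G B ∩ Z i).Nonempty := by
      rw [← Finset.card_pos]
      have : (0 : ℝ) < (nbrs G B ∩ Z i).card := by linarith
      exact_mod_cast this
    obtain ⟨z, hz⟩ := hne
    obtain ⟨hzn, hzZ⟩ := Finset.mem_inter.1 hz
    obtain ⟨b, hb, hbz⟩ := mem_nbrs.1 hzn
    refine ⟨fun i => if i = 0 then b else z, ?_, by simpa using hb, i, hi, by simpa using hzZ, ?_⟩
    · intro i j hij hj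
      obtain rfl : i = 0 := by omega
      obtain rfl : j = 1 := by omega
      simp [hbz, hbz.ne]
    · intro s h1 h2; omega
  | succ t ih =>
    have h2δ : ∀ i ∈ I, 2 * δ ≤ ((Z i).card : ℝ) := by
      intro i hi
      have h1 := hZ i hi
      have h2 : (1 : ℝ) ≤ 2 ^ (t + 1) := one_le_pow₀ (by norm_num)
      rw [pow_succ] at h1
      nlinarith
    -- The part of block b seen by M is the new starting set: having γ vertices, it reaches nearly
    -- all of every surviving block. Those blocks lose the neighbours of M, at most half of each,
    -- whence the powers of 2.
    obtain ⟨b, hb, M, hMB, hMγ, hK⟩ := exists_subset_missing_many (K := blockBound m t) hν hγ hγν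
      he hV hdeg hδ hI h2δ hB
    set I' := I.filter fun a => a < b ∧ (Z a).card ≤ 2 * (Z a \ nbrs G M).card with hI'
    have hmemI' : ∀ a ∈ I', a ∈ I ∧ a < b ∧ (Z a).card ≤ 2 * (Z a \ nbrs G M).card := by
      intro a ha
      simpa [hI'] using ha
    have hbig : ∀ a ∈ I', 2 ^ (t + 1) * δ ≤ ((Z a \ nbrs G M).card : ℝ) := by
      intro a ha
      obtain ⟨haI, -, hc⟩ := hmemI' a ha
      have h1 := hZ a haI
      have h2 : ((Z a).card : ℝ) ≤ 2 * (Z a \ nbrs G M).card := by exact_mod_cast hc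
      rw [pow_succ] at h1
      linarith
    have hVdisj : ∀ a ∈ I', Disjoint (nbrs G M ∩ Z b) (Z a \ nbrs G M) := by
      intro a ha
      rw [Finset.disjoint_left]
      intro w hw hw'
      simp_all
    obtain ⟨g, hg, hg0, i, hi, hgi, hgs⟩ := ih (I := I') (Z := fun a => Z a \ nbrs G M)
      (B := nbrs G M ∩ Z b) hK
      (fun i hi j hj hij => (hdisj i (hmemI' i hi).1 j (hmemI' j hj).1 hij).mono
        Finset.sdiff_subset Finset.sdiff_subset) hVdisj hbig (by
        intro a ha
        have h1 := hcoh.card_le_card_nbrs_inter hMγ (hVdisj a ha)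
        have h2 := hbig a ha
        have h3 : (1 : ℝ) ≤ 2 ^ t := one_le_pow₀ (by norm_num)
        rw [pow_succ] at h2
        nlinarith)
    obtain ⟨hg0M, hg0b⟩ := Finset.mem_inter.1 hg0
    obtain ⟨b₀, hb₀, hadj⟩ := mem_nbrs.1 hg0M
    have hblock : ∀ s, 1 ≤ s → s ≤ t + 1 → ∃ a ∈ I', g s ∈ Z a \ nbrs G M := by
      intro s h1 h2
      rcases Nat.lt_or_ge t s with h | h
      · obtain rfl : s = t + 1 := by omega
        exact ⟨i, hi, hgi⟩
      · obtain ⟨a, ha, -, has⟩ := hgs s h1 h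
        exact ⟨a, ha, has⟩
    -- Prepending b₀ ∈ M creates no chord, since all vertices of g after the first avoid the
    -- neighbours of M.
    have hpath := IsInducedPath.append (G := G) (f := fun _ => b₀) (g := g) (d := 0) (e := t + 1)
      (by intro i j hij hj; omega) hg (by
        intro i s _ hs heq
        rcases Nat.eq_zero_or_pos s with rfl | hs0
        · exact hadj.ne heq
        · obtain ⟨a, ha, hga⟩ := hblock s hs0 hs
          refine Finset.disjoint_left.1 (hBZ a (hmemI' a ha).1) (hMB hb₀) ?_
          rw [heq]
          exact (Finset.mem_sdiff.1 hga).1) (by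
        intro i s hi0 hs
        constructor
        · intro h
          refine ⟨by omega, ?_⟩
          by_contra hs0
          obtain ⟨a, ha, hga⟩ := hblock s (by omega) hs
          exact (Finset.mem_sdiff.1 hga).2 (mem_nbrs.2 ⟨b₀, hb₀, h⟩)
        · rintro ⟨-, rfl⟩
          exact hadj)
    rw [show 0 + (t + 1) + 1 = t + 1 + 1 by ring] at hpath
    refine ⟨_, hpath, by simpa using hMB hb₀, i, (hmemI' i hi).1, ?_, ?_⟩
    · simpa using (Finset.mem_sdiff.1 hgi).1
    · intro s h1 h2
      rcases Nat.lt_or_ge 1 s with h | h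
      · obtain ⟨a, ha, hia, has⟩ := hgs (s - 1) (by omega) (by omega)
        refine ⟨a, (hmemI' a ha).1, hia, ?_⟩
        simpa [show ¬ s = 0 by omega] using (Finset.mem_sdiff.1 has).1
      · obtain rfl : s = 1 := by omega
        exact ⟨b, hb, (hmemI' i hi).2.1, by simpa using hg0b⟩

/-! ### Chains of neighbourhoods and the root -/

theorem ball_subset_ball_succ {G : SimpleGraph V} {R : Finset V} {x x' : V} (hx' : x' ∈ R)
    (h : G.Adj x x') (j : ℕ) : ball G R x' j ⊆ ball G R x (j + 1) := by
  induction j with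
  | zero =>
    intro w hw
    obtain rfl : w = x' := by simpa [ball] using hw
    exact mem_ball_succ_of_adj (by simp [ball]) hx' h
  | succ j ih =>
    exact Finset.union_subset_union ih (Finset.inter_subset_inter_right (nbrs_mono ih))

/-- Discrete continuity: each added vertex contributes fewer than e new neighbours, so the count
cannot jump over the window from s to s + e. -/
theorem exists_superset_nbrs {G : SimpleGraph V} {e s : ℝ}
    (hdeg : ∀ v, ((nbrs G {v}).card : ℝ) < e) {A L Ω : Finset V} (hAL : A ⊆ L)
    (hA : ((nbrs G A ∩ Ω).card : ℝ) < s + e) (hL : s ≤ ((nbrs G L ∩ Ω).card : ℝ)) :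
    ∃ A', A ⊆ A' ∧ A' ⊆ L ∧ s ≤ ((nbrs G A' ∩ Ω).card : ℝ) ∧
      ((nbrs G A' ∩ Ω).card : ℝ) < s + e := by
  induction hk : (L \ A).card generalizing A with
  | zero =>
    have : L ⊆ A := Finset.sdiff_eq_empty_iff_subset.1 (Finset.card_eq_zero.1 hk)
    obtain rfl := this.antisymm hAL
    exact ⟨L, subset_rfl, subset_rfl, hL, hA⟩
  | succ k ih =>
    rcases le_or_gt s ((nbrs G A ∩ Ω).card : ℝ) with h | h
    · exact ⟨A, subset_rfl, hAL, h, hA⟩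
    · obtain ⟨u, hu⟩ := Finset.card_pos.1 (show 0 < (L \ A).card by omega)
      obtain ⟨huL, huA⟩ := Finset.mem_sdiff.1 hu
      have hsub : nbrs G (insert u A) ∩ Ω ⊆ nbrs G {u} ∪ (nbrs G A ∩ Ω) := by
        rw [Finset.insert_eq, nbrs_union]
        intro w
        simp only [Finset.mem_inter, Finset.mem_union]
        tauto
      have hc : ((nbrs G (insert u A) ∩ Ω).card : ℝ) ≤
          (nbrs G {u}).card + (nbrs G A ∩ Ω).card := by
        exact_mod_cast (Finset.card_le_card hsub).trans (Finset.card_union_le _ _)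
      have hcard : (L \ insert u A).card = k := by
        rw [Finset.sdiff_insert, Finset.card_erase_of_mem hu, hk]
        rfl
      obtain ⟨A', h1, h2, h3⟩ := ih (Finset.insert_subset huL hAL)
        (by linarith [hdeg u]) hcard
      exact ⟨A', (Finset.subset_insert _ _).trans h1, h2, h3⟩

theorem exists_chain_nbrs {G : SimpleGraph V} {e b : ℝ} (he : 0 < e) (hb : 0 ≤ b)
    (hdeg : ∀ v, ((nbrs G {v}).card : ℝ) < e) {L Ω : Finset V} (K : ℕ)
    (hL : K * b ≤ ((nbrs G L ∩ Ω).card : ℝ)) :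
    ∃ A : ℕ → Finset V, (∀ i ≤ K, A i ⊆ L) ∧ (∀ i j, i ≤ j → j ≤ K → A i ⊆ A j) ∧
      ∀ i ≤ K, i * b ≤ ((nbrs G (A i) ∩ Ω).card : ℝ) ∧
        ((nbrs G (A i) ∩ Ω).card : ℝ) < i * b + e := by
  induction K with
  | zero =>
    refine ⟨fun _ => ∅, by simp, by simp, ?_⟩
    intro i hi
    obtain rfl : i = 0 := by omega
    have : nbrs G ∅ = ∅ := by ext; simp
    simp [this, he]
  | succ K ih =>
    have hK : (K : ℝ) * b ≤ ((K + 1 : ℕ) : ℝ) * b := by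
      push_cast; nlinarith
    obtain ⟨A, hAL, hAmono, hA⟩ := ih (hK.trans hL)
    obtain ⟨A', h1, h2, h3⟩ := exists_superset_nbrs hdeg (hAL K le_rfl)
      (by linarith [(hA K le_rfl).2]) hL
    refine ⟨fun i => if i ≤ K then A i else A', ?_, ?_, ?_⟩
    · intro i hi
      by_cases h : i ≤ K
      · simpa [h] using hAL i h
      · simpa [h] using h2
    · intro i j hij hj
      by_cases hjK : j ≤ K
      · simpa [hjK, hij.trans hjK] using hAmono i j hij hjK
      · by_cases hiK : i ≤ K
        · simpa [hjK, hiK] using (hAmono i K hiK le_rfl).trans h1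
        · simp [hjK, hiK]
    · intro i hi
      by_cases h : i ≤ K
      · simpa [h] using hA i h
      · obtain rfl : i = K + 1 := by omega
        simpa using h3

/-- Either growth has reached size e ≥ γ, or the ball has ν^(m-1) = n/ν ≥ e/ν = γ vertices. -/
theorem le_card_ball {G : SimpleGraph V} {γ ν e : ℝ} {m : ℕ} (hm : 1 ≤ m) (hν : 1 < ν)
    (hγ : 0 ≤ γ) (hγν : γ * ν = e) (hV : ν ^ m = (Fintype.card V : ℝ))
    (heV : e ≤ Fintype.card V) {R : Finset V}
    (hR : ∀ Y ⊆ R, Y.Nonempty → (Y.card : ℝ) * ν ≤ ((Y ∪ (nbrs G Y ∩ R)).card : ℝ) ∨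
        e ≤ ((Y ∪ (nbrs G Y ∩ R)).card : ℝ)) {x : V} (hx : x ∈ R) :
    γ ≤ ((ball G R x (m - 1)).card : ℝ) := by
  rcases card_ball_ge hν.le hR hx (m - 1) with h | h
  · refine le_trans ?_ h
    have : ν ^ (m - 1) * ν = ν ^ m := by rw [← pow_succ]; congr 1; omega
    have h2 : γ * ν ≤ ν ^ (m - 1) * ν := by rw [this, hγν, hV]; exact heV
    exact le_of_mul_le_mul_right h2 (by linarith)
  · nlinarith

/-- There are a small connected set and a set `S` of vertices attached to it that reaches many
further vertices, such that any two vertices of `S` are joined by a short induced path through the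
connected set. -/
theorem exists_root {G : SimpleGraph V} {γ ν e θ : ℝ} {m : ℕ} (hm : 1 ≤ m) (hν : 1 < ν)
    (hγ : 0 ≤ γ) (hγν : γ * ν = e) (he : 1 ≤ e) (hV : ν ^ m = (Fintype.card V : ℝ))
    (hdeg : ∀ v, ((nbrs G {v}).card : ℝ) < e) (hcoh : IsCoherent G γ e)
    (hθ : 2 * e ≤ θ) (hθV : m * θ ≤ Fintype.card V - e) (heV : 3 * e ≤ Fintype.card V) :
    ∃ C S : Finset V, S ⊆ nbrs G C ∧
      (Fintype.card V : ℝ) - m * θ ≤ ((Finset.univ \ (C ∪ nbrs G C)).card : ℝ) ∧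
      θ ≤ ((nbrs G S ∩ (Finset.univ \ (C ∪ nbrs G C))).card : ℝ) ∧
      ∀ p ∈ S, ∀ q ∈ S, p ≠ q → ∃ d ∈ Finset.Icc 1 (2 * m), ∃ h : ℕ → V,
        IsInducedPath G h d ∧ h 0 = p ∧ h d = q ∧ ∀ i, 0 < i → i < d → h i ∈ C := by
  obtain ⟨R, -, hRc, hR⟩ := exists_expanding hcoh (by linarith) hγ hγν (R := Finset.univ)
    (by simpa using heV)
  rw [Finset.card_univ] at hRc
  obtain ⟨v, hv⟩ := Finset.card_pos.1 (show 0 < R.card by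
    have : (0 : ℝ) < R.card := by linarith
    exact_mod_cast this)
  set c : ℕ → Finset V := fun j => ball G R v j ∪ nbrs G (ball G R v j) with hc
  have hlast : (((m - 1 : ℕ) : ℝ) + 1) * θ ≤ ((c (m - 1)).card : ℝ) := by
    have h1 := le_card_ball hm hν hγ hγν hV (by linarith) hR hv
    have h2 := hcoh.card_sdiff_lt h1 Finset.univ
    have h3 := card_eq_card_sdiff_add (Finset.univ : Finset V) (c (m - 1))
    rw [Finset.inter_univ, Finset.card_univ] at h3
    have h4 : ((m - 1 : ℕ) : ℝ) + 1 = m := by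
      rw [Nat.cast_sub hm]; simp
    rw [h4]
    simp only [hc] at h3 ⊢
    linarith
  -- At the first radius k + 1 meeting its threshold, the ball of radius k serves as C: its closed
  -- neighbourhood is still small. The thresholds grow by θ, so the sphere S of radius k + 1 sees θ
  -- vertices of Ω.
  have hfin : ∃ j : ℕ, ((j : ℝ) + 1) * θ ≤ ((c j).card : ℝ) := ⟨m - 1, hlast⟩
  classical
  have hj := Nat.find_spec hfin
  have hjmin : ∀ i < Nat.find hfin, ((c i).card : ℝ) < ((i : ℝ) + 1) * θ := fun i hi =>
    not_le.1 (Nat.find_min hfin hi)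
  have hjm : Nat.find hfin ≤ m - 1 := Nat.find_min' hfin hlast
  obtain ⟨k, hk⟩ : ∃ k, Nat.find hfin = k + 1 := by
    refine Nat.exists_eq_succ_of_ne_zero fun h0 => ?_
    rw [h0] at hj
    have h1 : ((c 0).card : ℝ) ≤ 1 + (nbrs G {v}).card := by
      have := Finset.card_union_le ({v} : Finset V) (nbrs G {v})
      rw [Finset.card_singleton] at this
      exact_mod_cast this
    have := hdeg v
    simp only [Nat.cast_zero] at hj
    linarith
  rw [hk] at hj hjmin hjm
  have hck := hjmin k (by omega)
  have hkm : ((k : ℝ) + 1) * θ ≤ m * θ := by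
    have : (k : ℝ) + 1 ≤ m := by exact_mod_cast (by omega : k + 1 ≤ m)
    exact mul_le_mul_of_nonneg_right this (by linarith)
  have hSmem : ∀ p ∈ ball G R v (k + 1) \ ball G R v k,
      ∃ f : ℕ → V, IsInducedPath G f (k + 1) ∧ f 0 = v ∧ f (k + 1) = p ∧
        ∀ i ≤ k, f i ∈ ball G R v k := by
    intro p hp
    obtain ⟨hp1, hp2⟩ := Finset.mem_sdiff.1 hp
    obtain ⟨f, hf, hf0, hfj, hfm⟩ := exists_inducedPath_of_mem_ball hp1
      fun i hi h => hp2 (ball_mono G R v (by omega) h)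
    exact ⟨f, hf, hf0, hfj, fun i hi => ball_mono G R v hi (hfm i (by omega))⟩
  refine ⟨ball G R v k, ball G R v (k + 1) \ ball G R v k, ?_, ?_, ?_, ?_⟩
  · intro w hw
    obtain ⟨hw1, hw2⟩ := Finset.mem_sdiff.1 hw
    exact (Finset.mem_inter.1 ((Finset.mem_union.1 hw1).resolve_left hw2)).1
  · have h3 := card_eq_card_sdiff_add (Finset.univ : Finset V) (c k)
    rw [Finset.inter_univ, Finset.card_univ] at h3
    simp only [hc] at h3 hck
    linarith
  · have hsub : c (k + 1) \ c k ⊆ nbrs G (ball G R v (k + 1) \ ball G R v k) ∩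
        (Finset.univ \ (ball G R v k ∪ nbrs G (ball G R v k))) := by
      intro w hw
      obtain ⟨hw1, hw2⟩ := Finset.mem_sdiff.1 hw
      refine Finset.mem_inter.2 ⟨?_, Finset.mem_sdiff.2 ⟨Finset.mem_univ _, hw2⟩⟩
      simp only [hc, Finset.mem_union, not_or] at hw1 hw2
      rcases hw1 with h | h
      · exfalso
        rcases Finset.mem_union.1 h with h | h
        · exact hw2.1 h
        · exact hw2.2 (Finset.mem_inter.1 h).1
      · obtain ⟨u, hu, huw⟩ := mem_nbrs.1 h
        refine mem_nbrs.2 ⟨u, Finset.mem_sdiff.2 ⟨hu, fun huk => ?_⟩, huw⟩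
        exact hw2.2 (mem_nbrs.2 ⟨u, huk, huw⟩)
    have h1 := card_sub_le_card_sdiff (c (k + 1)) (c k)
    have h2 := (Nat.cast_le (α := ℝ)).2 (Finset.card_le_card hsub)
    push_cast at hj
    linarith
  · intro p hp q hq hpq
    obtain ⟨f, hf, hf0, hfj, hfm⟩ := hSmem p hp
    obtain ⟨g, hg, hg0, hgj, hgm⟩ := hSmem q hq
    -- Going from p to v and on to q bounds the distance by 2(k + 1); a shortest path confined to C
    -- and q is induced.
    set R' := insert q (ball G R v k)
    have hvp : v ∈ ball G R' p (0 + (k + 1)) := by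
      have := mem_ball_of_walk (G := G) (R := R') (x := p) (s := 0) (d := k + 1)
        (f := fun i => f (k + 1 - i)) (by simp [ball, hfj])
        (fun i h1 h2 => Finset.mem_insert_of_mem (hfm _ (by omega)))
        (fun i hi => (hf.adj_iff (by omega) (by omega)).2 (by omega))
      simpa [hf0] using this
    have hqp : q ∈ ball G R' p (0 + (k + 1) + (k + 1)) := by
      have := mem_ball_of_walk (G := G) (R := R') (x := p) (s := 0 + (k + 1)) (d := k + 1)
        (f := g) (by rwa [hg0])
        (fun i h1 h2 => by
          rcases Nat.lt_or_ge k i with h | h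
          · obtain rfl : i = k + 1 := by omega
            rw [hgj]; exact Finset.mem_insert_self _ _
          · exact Finset.mem_insert_of_mem (hgm _ h))
        (fun i hi => (hg.adj_iff (by omega) (by omega)).2 (by omega))
      rwa [hgj] at this
    have hex : ∃ d, q ∈ ball G R' p d := ⟨_, hqp⟩
    obtain ⟨h, hh, hh0, hhd, hhm⟩ := exists_inducedPath_of_mem_ball (Nat.find_spec hex)
      fun i hi => Nat.find_min hex hi
    have hle := Nat.find_min' hex hqp
    have hpos : Nat.find hex ≠ 0 := by
      intro h0
      rw [h0, hh0] at hhd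
      exact hpq hhd
    refine ⟨Nat.find hex, Finset.mem_Icc.2 ⟨by omega, by omega⟩, h, hh, hh0, hhd, ?_⟩
    intro i hi0 hid
    have h1 := ball_subset G R' p i (hhm i hid.le)
    rcases Finset.mem_insert.1 h1 with h2 | h2
    · rw [← hh0] at h2
      have := hh.injOn hid.le (by omega) h2
      omega
    · rcases Finset.mem_insert.1 h2 with h3 | h3
      · rw [← hhd] at h3
        have := hh.injOn hid.le le_rfl h3
        omega
      · exact h3

/-! ### Assembling the cycle -/

/-- A sparse coherent graph has an induced cycle of length `l`, for absolute bounds that decrease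
fast enough. -/
theorem hasInducedCycle_of_bounds {G : SimpleGraph V} {γ ν e δ w b θ : ℝ} {m l : ℕ}
    (hm : 1 ≤ m) (hl : 3 * m + 3 ≤ l) (hν : 1 < ν) (hγ : 0 ≤ γ) (hγν : γ * ν = e) (he : 1 ≤ e)
    (hV : ν ^ m = (Fintype.card V : ℝ)) (hdeg : ∀ v, ((nbrs G {v}).card : ℝ) < e)
    (hcoh : IsCoherent G γ e) (hδ : 3 * e < δ) (hw : (m + 2 ^ l) * δ ≤ w)
    (hb : 2 * m * w ≤ b - 2 * e)
    (hθ : (((2 * m * m * blockBound m l : ℕ) : ℝ) + 1) * b ≤ θ)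
    (hn : 4 * m * θ ≤ Fintype.card V) : HasInducedCycle G l := by
  classical
  set K := 2 * m * m * blockBound m l with hK
  have hm1 : (1 : ℝ) ≤ m := by exact_mod_cast hm
  have hδ0 : 0 < δ := by linarith
  have hw0 : 0 < w := lt_of_lt_of_le (by positivity) hw
  have hb0 : 2 * e ≤ b := by nlinarith
  have hbθ : b ≤ θ := by
    have : (0 : ℝ) ≤ K * b := mul_nonneg (by positivity) (by linarith)
    linarith
  have hθm : θ ≤ m * θ := by nlinarith
  have hγe : γ ≤ e := by nlinarith
  obtain ⟨C, S, hSC, hΩ, hSΩ, hpath⟩ := exists_root (θ := θ) hm hν hγ hγν he hV hdeg hcoh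
    (by linarith) (by linarith) (by linarith)
  set Ω := Finset.univ \ (C ∪ nbrs G C) with hΩdef
  have hCΩ : ∀ a ∈ C, ∀ u ∈ Ω, a ≠ u ∧ ¬ G.Adj a u := by
    intro a ha u hu
    have hu' := (Finset.mem_sdiff.1 hu).2
    exact ⟨fun h => hu' (Finset.mem_union_left _ (h ▸ ha)),
      fun h => hu' (Finset.mem_union_right _ (mem_nbrs.2 ⟨a, ha, h⟩))⟩
  have hSΩ' : ∀ a ∈ S, ∀ u ∈ Ω, a ≠ u := by
    rintro a ha u hu rfl
    exact (Finset.mem_sdiff.1 hu).2 (Finset.mem_union_right _ (hSC ha))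
  obtain ⟨A, hAS, hAmono, hA⟩ := exists_chain_nbrs (G := G) (L := S) (Ω := Ω) (by linarith : 0 < e)
    (by linarith : 0 ≤ b) hdeg (K + 1) (by push_cast; linarith)
  set Z : ℕ → Finset V := fun i => (nbrs G (A (i + 1)) ∩ Ω) \ nbrs G (A i) with hZ
  have hZΩ : ∀ i, Z i ⊆ Ω := fun i => Finset.sdiff_subset.trans Finset.inter_subset_right
  have hZc : ∀ i ≤ K, b - e ≤ ((Z i).card : ℝ) := by
    intro i hi
    have h1 := (hA (i + 1) (by omega)).1
    have h2 := (hA i (by omega)).2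
    have h3 := card_eq_card_sdiff_add (nbrs G (A (i + 1)) ∩ Ω) (nbrs G (A i))
    have h4 : ((nbrs G (A i) ∩ (nbrs G (A (i + 1)) ∩ Ω)).card : ℝ) ≤
        (nbrs G (A i) ∩ Ω).card := by
      exact_mod_cast Finset.card_le_card (by intro u; simp only [Finset.mem_inter]; tauto)
    push_cast at h1
    simp only [hZ]
    linarith
  have hZpriv : ∀ i j, i < j → j ≤ K → ∀ a ∈ A (i + 1), ∀ u ∈ Z j, ¬ G.Adj a u := by
    intro i j hij hj a ha u hu h
    exact (Finset.mem_sdiff.1 hu).2 (mem_nbrs.2 ⟨a, hAmono (i + 1) j (by omega) (by omega) ha, h⟩)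
  have hZdisj : ∀ i j, i < j → j ≤ K → Disjoint (Z i) (Z j) := by
    intro i j hij hj
    rw [Finset.disjoint_left]
    intro u hui huj
    obtain ⟨a, ha, hau⟩ := mem_nbrs.1 (Finset.mem_inter.1 (Finset.mem_sdiff.1 hui).1).1
    exact hZpriv i j hij hj a ha u huj hau
  have hFc : 3 * e ≤ ((Ω \ nbrs G (A (K + 1))).card : ℝ) := by
    have h1 := card_eq_card_sdiff_add Ω (nbrs G (A (K + 1)))
    have h2 := (hA (K + 1) le_rfl).2
    push_cast at h2
    linarith
  -- F avoids all neighbours of the chain, so neither p nor q will have a neighbour in F.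
  obtain ⟨F, hFsub, hFc', hF⟩ := exists_expanding hcoh (by linarith) hγ hγν hFc
  have hFΩ : F ⊆ Ω := hFsub.trans Finset.sdiff_subset
  have hFA : ∀ a ∈ A (K + 1), ∀ u ∈ F, ¬ G.Adj a u := fun a ha u hu h =>
    (Finset.mem_sdiff.1 (hFsub hu)).2 (mem_nbrs.2 ⟨a, ha, h⟩)
  have hZF : ∀ i ≤ K, Disjoint (Z i) F := by
    intro i hi
    rw [Finset.disjoint_left]
    intro u hu huF
    obtain ⟨a, ha, hau⟩ := mem_nbrs.1 (Finset.mem_inter.1 (Finset.mem_sdiff.1 hu).1).1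
    exact hFA a (hAmono (i + 1) (K + 1) (by omega) le_rfl ha) u huF hau
  obtain ⟨x, hxZ, x', hx'F, hxx'⟩ : ∃ x ∈ Z K, ∃ x' ∈ F, G.Adj x x' := by
    have h1 := hcoh.card_le_card_nbrs_inter (A := Z K) (by linarith [hZc K le_rfl]) (hZF K le_rfl)
    have h2 : (0 : ℝ) < (nbrs G (Z K) ∩ F).card := by linarith
    obtain ⟨x', hx'⟩ := Finset.card_pos.1 (by exact_mod_cast h2)
    obtain ⟨hx'n, hx'F⟩ := Finset.mem_inter.1 hx'
    obtain ⟨x, hx, h⟩ := mem_nbrs.1 hx'n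
    exact ⟨x, hx, x', hx'F, h⟩
  obtain ⟨p, hpA, hpx⟩ := mem_nbrs.1 (Finset.mem_inter.1 (Finset.mem_sdiff.1 hxZ).1).1
  have hpS : p ∈ S := hAS _ le_rfl hpA
  let Conn : ℕ → ℕ → V → Prop := fun d i y => ∃ q ∈ A (i + 1), G.Adj q y ∧
    ∃ h : ℕ → V, IsInducedPath G h d ∧ h 0 = p ∧ h d = q ∧ ∀ i, 0 < i → i < d → h i ∈ C
  have hConn : ∀ i < K, ∀ y ∈ Z i, ∃ d ∈ Finset.Icc 1 (2 * m), Conn d i y := by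
    intro i hi y hy
    obtain ⟨q, hq, hqy⟩ := mem_nbrs.1 (Finset.mem_inter.1 (Finset.mem_sdiff.1 hy).1).1
    have hpq : p ≠ q := by
      rintro rfl
      exact hZpriv i K hi le_rfl p hq x hxZ hpx
    obtain ⟨d, hd, h, hh⟩ := hpath p hpS q (hAS _ (by omega) hq) hpq
    exact ⟨d, hd, q, hq, hqy, h, hh⟩
  -- Pigeonhole on the length of the p–q path, after removing the neighbours of p so that x stays
  -- its only neighbour on the long arc.
  have hdist : ∀ i : ℕ, ∃ d ∈ Finset.Icc 1 (2 * m), i < K →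
      w ≤ (((Z i \ nbrs G {p}).filter (Conn d i)).card : ℝ) := by
    intro i
    by_cases hi : i < K
    · have hch : ∀ y, ∃ d, y ∈ Z i → d ∈ Finset.Icc 1 (2 * m) ∧ Conn d i y := by
        intro y
        by_cases hy : y ∈ Z i
        · obtain ⟨d, h1, h2⟩ := hConn i hi y hy
          exact ⟨d, fun _ => ⟨h1, h2⟩⟩
        · exact ⟨0, fun h => absurd h hy⟩
      choose D hD using hch
      obtain ⟨d, hd, hdc⟩ := Finset.exists_le_card_fiber_of_nsmul_le_card_of_maps_to
        (s := Z i \ nbrs G {p}) (t := Finset.Icc 1 (2 * m)) (f := D) (b := w)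
        (fun y hy => (hD y (Finset.mem_sdiff.1 hy).1).1) ⟨1, by simp; omega⟩ (by
          rw [Nat.card_Icc, nsmul_eq_mul]
          have h1 := card_sub_le_card_sdiff (Z i) (nbrs G {p})
          have h2 := hZc i hi.le
          have h3 := hdeg p
          push_cast [Nat.add_sub_cancel]
          linarith)
      refine ⟨d, hd, fun _ => hdc.trans ?_⟩
      exact_mod_cast Finset.card_le_card (by
        intro y hy
        obtain ⟨h1, rfl⟩ := Finset.mem_filter.1 hy
        exact Finset.mem_filter.2 ⟨h1, (hD y (Finset.mem_sdiff.1 h1).1).2⟩)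
    · exact ⟨1, by simp; omega, fun h => absurd h hi⟩
  choose D hD hDw using hdist
  set W : ℕ → Finset V := fun i => (Z i \ nbrs G {p}).filter (Conn (D i) i) with hW
  have hWZ : ∀ i, W i ⊆ Z i := fun i => (Finset.filter_subset _ _).trans Finset.sdiff_subset
  have hballΩ : ∀ j, ball G F x j ⊆ insert x F := ball_subset G F x
  have hballZ : ∀ i < K, ∀ j, Disjoint (ball G F x j) (Z i) := by
    intro i hi j
    refine Disjoint.mono_left (hballΩ j) ?_
    rw [Finset.disjoint_insert_left]
    exact ⟨Finset.disjoint_right.1 (hZdisj i K hi le_rfl) hxZ, (hZF i hi.le).symm⟩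
  have hballm : γ ≤ ((ball G F x m).card : ℝ) := by
    have h1 := le_card_ball hm hν hγ hγν hV (by linarith) hF hx'F
    have h2 := ball_subset_ball_succ hx'F hxx' (m - 1)
    rw [Nat.sub_add_cancel hm] at h2
    exact h1.trans (by exact_mod_cast Finset.card_le_card h2)
  -- Rising thresholds again: at the first radius j + 1 meeting its threshold, the new sphere alone
  -- adds δ neighbours in W i. Radius 0 fails by sparsity; radius m succeeds by coherence.
  have hrad : ∀ i : ℕ, ∃ j, j + 1 ∈ Finset.Icc 1 m ∧ (i < K →
      ((nbrs G (ball G F x j) ∩ W i).card : ℝ) < (j + 1) * δ ∧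
      (j + 1) * δ + δ ≤ ((nbrs G (ball G F x (j + 1)) ∩ W i).card : ℝ)) := by
    intro i
    by_cases hi : i < K
    · have hlast : ((m : ℝ) + 1) * δ ≤ ((nbrs G (ball G F x m) ∩ W i).card : ℝ) := by
        have h1 := hcoh.card_le_card_nbrs_inter hballm ((hballZ i hi m).mono_right (hWZ i))
        have h2 := hDw i hi
        have h3 : (2 : ℝ) * δ ≤ 2 ^ l * δ := by
          refine mul_le_mul_of_nonneg_right ?_ hδ0.le
          calc (2 : ℝ) = 2 ^ 1 := by norm_num
            _ ≤ 2 ^ l := pow_le_pow_right₀ (by norm_num) (by omega)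
        simp only [hW] at h1 ⊢
        linarith
      have hex : ∃ j : ℕ, ((j : ℝ) + 1) * δ ≤ ((nbrs G (ball G F x j) ∩ W i).card : ℝ) :=
        ⟨m, hlast⟩
      have hspec := Nat.find_spec hex
      have hmin := Nat.find_min' hex hlast
      obtain ⟨j, hj⟩ : ∃ j, Nat.find hex = j + 1 := by
        refine Nat.exists_eq_succ_of_ne_zero fun h0 => ?_
        rw [h0] at hspec
        have h1 : ((nbrs G (ball G F x 0) ∩ W i).card : ℝ) ≤ (nbrs G {x}).card := by
          exact_mod_cast Finset.card_le_card Finset.inter_subset_left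
        have := hdeg x
        simp only [Nat.cast_zero] at hspec
        linarith
      have hj' := Nat.find_min hex (m := j) (by omega)
      rw [hj] at hspec hmin
      refine ⟨j, Finset.mem_Icc.2 ⟨by omega, hmin⟩, fun _ => ⟨not_le.1 hj', ?_⟩⟩
      push_cast at hspec
      linarith
    · exact ⟨0, by simp; omega, fun h => absurd h hi⟩
  choose J hJ hJc using hrad
  -- There are 2m · m possible pairs, hence the factor in K.
  obtain ⟨⟨d, j'⟩, hdj, hcard⟩ := Finset.exists_le_card_fiber_of_mul_le_card_of_maps_to
    (s := Finset.range K) (t := Finset.Icc 1 (2 * m) ×ˢ Finset.Icc 1 m)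
    (f := fun i => (D i, J i + 1)) (n := blockBound m l)
    (fun i _ => Finset.mem_product.2 ⟨hD i, hJ i⟩) ⟨(1, 1), by simp; omega⟩
    (by simp [hK])
  set I := (Finset.range K).filter fun i => (D i, J i + 1) = (d, j') with hI
  obtain ⟨hd1, hj1⟩ := Finset.mem_product.1 hdj
  simp only [Finset.mem_Icc] at hd1 hj1
  obtain ⟨j, rfl⟩ : ∃ j, j' = j + 1 := ⟨j' - 1, by omega⟩
  have hImem : ∀ i ∈ I, i < K ∧ D i = d ∧ J i = j := by
    intro i hi
    simpa [hI] using hi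
  obtain ⟨t, ht⟩ : ∃ t, l = d + ((j + 1) + t + 1) + 2 := ⟨l - (d + j + 4), by omega⟩
  have hsub : ∀ i : ℕ, (nbrs G (ball G F x (j + 1)) ∩ W i) \ (nbrs G (ball G F x j) ∩ W i) ⊆
      nbrs G (ball G F x (j + 1) \ ball G F x j) ∩ (W i \ nbrs G (ball G F x j)) := by
    intro i u hu
    simp only [Finset.mem_sdiff, Finset.mem_inter, not_and] at hu ⊢
    obtain ⟨⟨hu1, hu2⟩, hu3⟩ := hu
    have hu4 : u ∉ nbrs G (ball G F x j) := fun h => hu3 h hu2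
    obtain ⟨a, ha, hau⟩ := mem_nbrs.1 hu1
    exact ⟨mem_nbrs.2 ⟨a, Finset.mem_sdiff.2 ⟨ha, fun h => hu4 (mem_nbrs.2 ⟨a, h, hau⟩)⟩, hau⟩,
      hu2, hu4⟩
  obtain ⟨g, hg, hg0, i, hi, hgi, hgs⟩ := exists_descending_path hν hγ hγν (by linarith) hV hdeg
    hcoh hδ t (I := I) (Z := fun i => W i \ nbrs G (ball G F x j))
    (B := ball G F x (j + 1) \ ball G F x j)
    ((blockBound_mono m (by omega)).trans hcard)
    (by
      intro a ha a' ha' hne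
      have h1 := (hImem a ha).1
      have h2 := (hImem a' ha').1
      have : Disjoint (Z a) (Z a') := by
        rcases lt_or_gt_of_ne hne with h | h
        · exact hZdisj a a' h h2.le
        · exact (hZdisj a' a h h1.le).symm
      exact this.mono (Finset.sdiff_subset.trans (hWZ a)) (Finset.sdiff_subset.trans (hWZ a')))
    (fun a ha => (hballZ a (hImem a ha).1 (j + 1)).mono Finset.sdiff_subset
      (Finset.sdiff_subset.trans (hWZ a)))
    (by
      intro a ha
      obtain ⟨haK, -, haJ⟩ := hImem a ha
      have h1 := (hJc a haK).1
      rw [haJ] at h1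
      have h2 := card_eq_card_sdiff_add (W a) (nbrs G (ball G F x j))
      have h3 := hDw a haK
      have h4 : ((j : ℝ) + 1) * δ ≤ m * δ := by
        refine mul_le_mul_of_nonneg_right ?_ hδ0.le
        exact_mod_cast hj1.2
      have h5 : (2 : ℝ) ^ (t + 1) * δ ≤ 2 ^ l * δ := by
        refine mul_le_mul_of_nonneg_right (pow_le_pow_right₀ (by norm_num) (by omega)) hδ0.le
      simp only [hW] at h1 h2 ⊢
      linarith)
    (by
      intro a ha
      obtain ⟨haK, -, haJ⟩ := hImem a ha
      obtain ⟨h1, h2⟩ := hJc a haK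
      rw [haJ] at h1 h2
      have h3 := (Nat.cast_le (α := ℝ)).2 (Finset.card_le_card (hsub a))
      have h4 := card_sub_le_card_sdiff (nbrs G (ball G F x (j + 1)) ∩ W a)
        (nbrs G (ball G F x j) ∩ W a)
      linarith)
  obtain ⟨hg0b, hg0b'⟩ := Finset.mem_sdiff.1 hg0
  obtain ⟨f, hf, hf0, hfj, hfm⟩ := exists_inducedPath_of_mem_ball hg0b
    fun i hi h => hg0b' (ball_mono G F x (by omega) h)
  obtain ⟨hiK, hDi, -⟩ := hImem i hi
  have hgt : g (t + 1) ∈ W i := (Finset.mem_sdiff.1 hgi).1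
  obtain ⟨q, hq, hqy, h, hh, hh0, hhd, hhC⟩ := (Finset.mem_filter.1 hgt).2
  rw [hDi] at hh hhd hhC
  have hgW : ∀ s ≤ t, ∃ i' < K, i ≤ i' ∧ (s ≠ t → i < i') ∧ g (s + 1) ∈ W i' ∧
      g (s + 1) ∉ nbrs G (ball G F x j) := by
    intro s hs
    rcases Nat.lt_or_ge s t with hst | hst
    · obtain ⟨i', hi', hii', hgi'⟩ := hgs (s + 1) (by omega) (by omega)
      exact ⟨i', (hImem i' hi').1, hii'.le, fun _ => hii', (Finset.mem_sdiff.1 hgi').1,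
        (Finset.mem_sdiff.1 hgi').2⟩
    · obtain rfl : s = t := by omega
      exact ⟨i, hiK, le_rfl, fun h => absurd rfl h, hgt, (Finset.mem_sdiff.1 hgi).2⟩
  have hfF : ∀ s ≤ j + 1, f s ∈ insert x F := fun s hs => hballΩ s (hfm s hs)
  -- The first vertex of g is dropped because it is already the last vertex of f.
  have hP := hf.append hg.tail (by
      intro a s ha hs heq
      obtain ⟨i', hi', -, -, hgs', -⟩ := hgW s hs
      refine Finset.disjoint_left.1 (hballZ i' hi' a) (hfm a ha) ?_
      rw [heq]
      exact hWZ i' hgs') (by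
      intro a s ha hs
      rcases Nat.lt_or_ge a (j + 1) with haj | haj
      · refine ⟨fun hadj => ?_, fun h => by omega⟩
        obtain ⟨i', -, -, -, -, hgn⟩ := hgW s hs
        exact absurd (mem_nbrs.2 ⟨_, ball_mono G F x (by omega : a ≤ j) (hfm a ha), hadj⟩) hgn
      · obtain rfl : a = j + 1 := by omega
        rw [hfj, (hg 0 (s + 1) (by omega) (by omega)).2]
        omega)
  set P : ℕ → V := fun i => if i ≤ j + 1 then f i else g (i - (j + 1 + 1) + 1) with hPdef
  have hAi : A (i + 1) ⊆ A (K + 1) := hAmono _ _ (by omega) le_rfl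
  have hPfacts : ∀ s ≤ j + 1 + t + 1, P s ∈ Ω ∧ (G.Adj p (P s) ↔ s = 0) ∧
      (G.Adj q (P s) ↔ s = j + 1 + t + 1) := by
    intro s hs
    by_cases hsj : s ≤ j + 1
    · have hPs : P s = f s := by simp [hPdef, hsj]
      rw [hPs]
      rcases Nat.eq_zero_or_pos s with rfl | hs0
      · rw [hf0]
        refine ⟨hZΩ K hxZ, by simp [hpx], ?_⟩
        exact ⟨fun h => absurd h (hZpriv i K hiK le_rfl q hq x hxZ), fun h => by omega⟩
      · have hsF : f s ∈ F := by
          refine (Finset.mem_insert.1 (hfF s hsj)).resolve_left fun h => ?_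
          rw [← hf0] at h
          have := hf.injOn hsj (Nat.zero_le _) h
          omega
        exact ⟨hFΩ hsF, ⟨fun h => absurd h (hFA p hpA _ hsF), fun h => by omega⟩,
          ⟨fun h => absurd h (hFA q (hAi hq) _ hsF), fun h => by omega⟩⟩
    · obtain ⟨s', rfl⟩ : ∃ s', s = j + 1 + 1 + s' := ⟨s - (j + 1 + 1), by omega⟩
      have hPs : P (j + 1 + 1 + s') = g (s' + 1) := by
        simp [hPdef, hsj]
      rw [hPs]
      obtain ⟨i', hi', -, hii', hgs', -⟩ := hgW s' (by omega)
      refine ⟨hZΩ _ (hWZ _ hgs'), ⟨fun h => ?_, fun h => by omega⟩, ⟨fun h => ?_, fun h => ?_⟩⟩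
      · have := (Finset.mem_sdiff.1 (Finset.mem_filter.1 hgs').1).2
        exact absurd (mem_nbrs.2 ⟨p, by simp, h⟩) this
      · by_contra hne
        exact hZpriv i i' (hii' (by omega)) hi'.le q hq _ (hWZ _ hgs') h
      · obtain rfl : s' = t := by omega
        exact hqy
  have hqS : q ∈ S := hAS _ (by omega) hq
  rw [ht]
  have hcases : ∀ a ≤ d, h a = p ∧ a = 0 ∨ h a = q ∧ a = d ∨ h a ∈ C ∧ 0 < a ∧ a < d := by
    intro a ha
    rcases Nat.eq_zero_or_pos a with rfl | ha0
    · exact Or.inl ⟨hh0, rfl⟩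
    · rcases Nat.lt_or_ge a d with had | had
      · exact Or.inr (Or.inr ⟨hhC a ha0 had, ha0, had⟩)
      · obtain rfl : a = d := by omega
        exact Or.inr (Or.inl ⟨hhd, rfl⟩)
  refine hh.hasInducedCycle hP hd1.1 (by omega) ?_ ?_
  · intro a s ha hs
    have hPs := (hPfacts s hs).1
    rcases hcases a ha with ⟨h1, -⟩ | ⟨h1, -⟩ | ⟨h1, -⟩
    · rw [h1]; exact hSΩ' p hpS _ hPs
    · rw [h1]; exact hSΩ' q hqS _ hPs
    · exact (hCΩ _ h1 _ hPs).1
  · intro a s ha hs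
    obtain ⟨hPs, hps, hqs⟩ := hPfacts s hs
    rcases hcases a ha with ⟨h1, h2⟩ | ⟨h1, h2⟩ | ⟨h1, h2, h3⟩
    · rw [h1, hps]; omega
    · rw [h1, hqs]; omega
    · exact ⟨fun hadj => absurd hadj (hCΩ _ h1 _ hPs).2, fun h => by omega⟩

end PurePairs

/-! ### Choice of constants -/

theorem theorem7p2 (c : ℝ) (hc : 0 < c) (hcint : ∃ m : ℤ, 1 / c = (m : ℝ))
    (l : ℕ) (hl : 3 / c + 3 ≤ (l : ℝ)) :
    ∃ ε : ℝ, 0 < ε ∧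
      ∀ (V : Type*) [Fintype V] (G : SimpleGraph V) [DecidableRel G.Adj],
        1 < Fintype.card V →
        PurePairs.IsSparse G ε →
        PurePairs.IsCoherent G (ε * (Fintype.card V : ℝ) ^ (1 - c)) (ε * (Fintype.card V : ℝ)) →
        PurePairs.HasInducedCycle G l := by
  obtain ⟨z, hz⟩ := hcint
  have hz0 : (0 : ℝ) < z := by rw [← hz]; positivity
  obtain ⟨m, rfl⟩ : ∃ m : ℕ, z = m := ⟨z.toNat, by
    have : (0 : ℤ) < z := by exact_mod_cast hz0
    omega⟩
  simp only [Int.cast_natCast] at hz hz0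
  have hm : 1 ≤ m := by exact_mod_cast hz0
  have hm1 : (1 : ℝ) ≤ m := by exact_mod_cast hm
  have hcm : c * m = 1 := by rw [← hz]; field_simp
  have hl' : 3 * m + 3 ≤ l := by
    have : (3 : ℝ) * m + 3 ≤ l := by rw [← hz]; convert hl using 2; ring
    exact_mod_cast this
  set K : ℝ := ((2 * m * m * PurePairs.blockBound m l : ℕ) : ℝ) with hK
  have hK0 : 0 ≤ K := Nat.cast_nonneg _
  -- Each scale is a fixed fraction of the previous one, as `hasInducedCycle_of_bounds` requires
  -- after multiplication by n; ε = δ/4 then gives 3e < δn.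
  set θ : ℝ := 1 / (4 * m) with hθ
  set b : ℝ := θ / (K + 1) with hb
  set w : ℝ := b / (4 * m) with hw
  set δ : ℝ := w / (m + 2 ^ l) with hδ
  have hθ0 : 0 < θ := by positivity
  have hb0 : 0 < b := by positivity
  have hw0 : 0 < w := by positivity
  have hδ0 : 0 < δ := by positivity
  have hδw : δ ≤ w := div_le_self hw0.le (by
    have : (0 : ℝ) < 2 ^ l := by positivity
    linarith)
  have hwb : w ≤ b := div_le_self hb0.le (by linarith)
  refine ⟨δ / 4, by positivity, ?_⟩
  intro V _ G _ hV hsp hco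
  classical
  set n : ℝ := (Fintype.card V : ℝ) with hn
  have hn1 : 1 < n := by rw [hn]; exact_mod_cast hV
  have hn0 : 0 < n := by linarith
  set ν : ℝ := n ^ c with hνdef
  have hν : 1 < ν := Real.one_lt_rpow hn1 hc
  have hνm : ν ^ m = n := by
    rw [hνdef, ← Real.rpow_natCast, ← Real.rpow_mul hn0.le, hcm, Real.rpow_one]
  have hγν : δ / 4 * n ^ (1 - c) * ν = δ / 4 * n := by
    rw [mul_assoc, hνdef, ← Real.rpow_add hn0]
    simp
  have hγ0 : 0 ≤ δ / 4 * n ^ (1 - c) := by positivity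
  have hdeg : ∀ v, ((PurePairs.nbrs G {v}).card : ℝ) < δ / 4 * n := by
    intro v
    have h1 : PurePairs.nbrs G {v} = G.neighborFinset v := by ext; simp
    rw [h1, G.card_neighborFinset_eq_degree]
    exact hsp v
  have he : 1 ≤ δ / 4 * n := by
    -- If εn < 1, sparsity leaves no edges, and two single vertices contradict coherence.
    by_contra! hlt
    obtain ⟨u, v, huv⟩ := Fintype.exists_pair_of_one_lt_card hV
    refine hco ⟨{u}, {v}, ⟨by simpa using huv, ?_⟩, ?_, ?_⟩
    · intro a ha b hb hab
      have h1 := (hdeg a).trans hlt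
      have h2 : (PurePairs.nbrs G {a}).card < 1 := by exact_mod_cast h1
      have h3 : b ∈ PurePairs.nbrs G {a} := by simpa using hab
      rw [Nat.lt_one_iff, Finset.card_eq_zero] at h2
      simp [h2] at h3
    · simp only [Finset.card_singleton, Nat.cast_one]
      nlinarith
    · simpa using hlt.le
  refine PurePairs.hasInducedCycle_of_bounds (δ := δ * n) (w := w * n) (b := b * n) (θ := θ * n) hm hl' hν hγ0
    hγν he hνm hdeg hco ?_ ?_ ?_ ?_ ?_
  · nlinarith
  · have h1 : (m + 2 ^ l : ℝ) * δ = w := by rw [hδ]; field_simp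
    rw [← mul_assoc, h1]
  · have h1 : 4 * m * w = b := by rw [hw]; field_simp
    have h2 : 2 * m * w ≤ b - 2 * (δ / 4) := by linarith
    calc 2 * m * (w * n) = 2 * m * w * n := by ring
      _ ≤ (b - 2 * (δ / 4)) * n := mul_le_mul_of_nonneg_right h2 hn0.le
      _ = _ := by ring
  · have h1 : (K + 1) * b = θ := by rw [hb]; field_simp
    rw [← mul_assoc, h1]
  · have h1 : 4 * m * θ = 1 := by rw [hθ]; field_simp
    rw [← mul_assoc, h1, one_mul]
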